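/- Let $\mathbb U=\{z\in\mathbb C:\operatorname{Im} z>0\}$ be the upper half plane with its hyperbolic metric $|dz|^2/y^2$, and let $\Phi=\Phi(z)\,dz^2$ be a holomorphic quadratic differential on $\mathbb U$, with pointwise norm $\|\Phi(z)\|=y^2|\Phi(z)|$ at $z=x+iy$. Let $0<r<\tfrac12$ and let $K$ be a real number with $K/r<\tfrac14$, and assume that $\|\Phi(z)\|\le K$ for every $z$ in the $r$-neighborhood (in the hyperbolic metric) of the imaginary axis in $\mathbb U$. Then there exists a locally univalent (that is, holomorphic and locally injective) map $f\colon\mathbb U\to\widehat{\mathbb C}=\mathbb C\cup\{\infty\}$ such that - $Sf=\Phi$ on $\mathbb U$, where $Sf=\left(\frac{f''}{f'}\right)'-\frac12\left(\frac{f''}{f'}\right)^2$ is the Schwarzian derivative (computed for $1/f$ in place of $f$ at the poles of $f$); - $f(it)\to 0$ as $t\to 0^+$ and $f(it)\to\infty$ as $t\to\infty$; - $f(i)=i$, $\;|f'(i)-1|\le \dfrac{9K}{r}\;$ and $\;\left|\dfrac1{f'(i)}-1\right|\le\dfrac{9K}{r}$. -/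

import Mathlib

open scoped UpperHalfPlane Manifold Topology OnePoint

namespace HalfPlane

/-- The geodesic of the hyperbolic plane `ℍ` given by the imaginary axis. -/
def imaginaryAxis : Set ℍ := {z : ℍ | z.re = 0}

/-- The pointwise norm of the quadratic differential `Φ(z) dz²` at `z = x + iy`: the ratio
`y² |Φ(z)|` of the area form `|Φ| dx dy` and the hyperbolic area form `dx dy / y²`. -/
noncomputable def quadNorm (Φ : ℍ → ℂ) (z : ℍ) : ℝ := z.im ^ 2 * ‖Φ z‖

/-- The standard charts of the Riemann sphere `OnePoint ℂ`. Around a finite point `p` it is the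
affine coordinate (meaningful away from `∞`), around `p = ∞` it is the coordinate `q ↦ 1 / q`
sending `∞` to `0` (meaningful away from `0`). -/
noncomputable def sphereChart (p q : OnePoint ℂ) : ℂ :=
  p.elim (q.elim 0 fun w => w⁻¹) (fun _ => q.elim 0 id)

/-- The expression of `f : ℍ → OnePoint ℂ` near `z`, in the standard coordinate of `ℍ` and the
chart of the sphere around `f z`, as a function of a complex variable. -/
noncomputable def localRep (f : ℍ → OnePoint ℂ) (z : ℍ) (w : ℂ) : ℂ :=
  sphereChart (f z) (f (UpperHalfPlane.ofComplex w))

/-- Holomorphic maps from the upper half plane to the Riemann sphere. -/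
def IsHolomorphic (f : ℍ → OnePoint ℂ) : Prop :=
  Continuous f ∧ ∀ z : ℍ, AnalyticAt ℂ (localRep f z) z

/-- Locally univalent maps to the Riemann sphere: holomorphic and locally injective. -/
def IsLocallyUnivalent (f : ℍ → OnePoint ℂ) : Prop :=
  IsHolomorphic f ∧ ∀ z : ℍ, ∃ U ∈ 𝓝 z, Set.InjOn f U

/-- The Schwarzian derivative `(g'' / g')' - (g'' / g')² / 2` of a function of a complex
variable. -/
noncomputable def schwarzian (g : ℂ → ℂ) (z : ℂ) : ℂ :=
  deriv (logDeriv (deriv g)) z - logDeriv (deriv g) z ^ 2 / 2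

/-- The Schwarzian derivative of a map to the Riemann sphere. As the Schwarzian is unchanged by
`g ↦ 1 / g`, it may be computed in any chart of the target; the chart around `f z` is used. -/
noncomputable def sphereSchwarzian (f : ℍ → OnePoint ℂ) (z : ℍ) : ℂ :=
  schwarzian (localRep f z) z

/-- The derivative at `z` of a map to the sphere, in the chart around `f z`; this is the usual
complex derivative `f'(z)` when `f z` is finite. -/
noncomputable def sphereDeriv (f : ℍ → OnePoint ℂ) (z : ℍ) : ℂ :=
  deriv (localRep f z) z

end HalfPlane

/-! A quotient `A / B` of independent solutions of `u'' = -(Φ/2) u` is locally univalent with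
Schwarzian derivative `Φ`, so everything rests on choosing the two solutions well. In the coordinate
`s ↦ i eˢ` on the imaginary axis, the logarithmic derivative `m` of a solution satisfies `m' = m -
m² - q/2`, where `q = z²Φ` has norm at most `K`. For `q = 0` the equilibria are `1` and `0`,
belonging to the solutions `z` and `1`. For small `q` each persists as a bounded solution on the
whole line, `1 + e(s)` and `-d(-s)`, with `e` and `d` bounded by `K`; this is a contraction argument
(`exists_bounded_riccati_solution`). Let `A` and `B` be the solutions with these logarithmic
derivatives, `A(i) = i` and `B(i) = 1`. Then `f(i eˢ) = i exp ∫₀ˢ (1 + e(t) + d(-t)) dt`, and `2K <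
1` forces the limits `0` and `∞`. The Wronskian gives `f'(i) = 1 + e(0) + d(0)`, within `2K` of `1`.
-/

/-! ### Holomorphic linear differential equations on convex domains -/

theorem exists_primitive_of_convex {E : Type*} [NormedAddCommGroup E] [NormedSpace ℂ E]
    [CompleteSpace E] {U : Set ℂ} (hU : IsOpen U) (hc : Convex ℝ U) (z₀ : ℂ) {g : ℂ → E}
    (hg : DifferentiableOn ℂ g U) :
    ∃ F : ℂ → E, F z₀ = 0 ∧ ∀ z ∈ U, HasDerivAt F (g z) z := by
  have hω : ∀ a ∈ U, HasFDerivAt (fun z => ContinuousLinearMap.toSpanSingleton ℂ (g z))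
      ((ContinuousLinearMap.toSpanSingletonCLE (𝕜 := ℂ) (E := E)).toContinuousLinearMap.comp
        (ContinuousLinearMap.toSpanSingleton ℂ (deriv g a))) a := by
    intro a ha
    have h1 := ((hg a ha).differentiableAt (hU.mem_nhds ha)).hasDerivAt.hasFDerivAt
    exact (ContinuousLinearMap.toSpanSingletonCLE (𝕜 := ℂ)
      (E := E)).toContinuousLinearMap.hasFDerivAt.comp a h1
  obtain ⟨f, hf⟩ := hc.exists_forall_hasFDerivAt_of_fderiv_symmetric hU
    (ω := fun z => ContinuousLinearMap.toSpanSingleton ℂ (g z))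
    (fun a ha => ((hω a ha).restrictScalars ℝ).differentiableAt.differentiableWithinAt)
    (by
      intro a ha x y
      rw [((hω a ha).restrictScalars ℝ).fderiv]
      simp [smul_smul, mul_comm])
  refine ⟨fun z => f z - f z₀, by simp, fun z hz => ?_⟩
  have := (hf z hz).hasDerivAt
  simpa using this.sub_const (f z₀)

/-- Picard iteration: `Y (n + 1)` is the primitive of `A · Y n` vanishing at `z₀`, and the solution
is `∑ Y n`. Factorial decay of the terms makes the series converge on all of `U`. -/
theorem exists_linear_ode_solution {E : Type*} [NormedAddCommGroup E] [NormedSpace ℂ E]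
    [CompleteSpace E] {U : Set ℂ} (hU : IsOpen U) (hc : Convex ℝ U) {z₀ : ℂ} (hz₀ : z₀ ∈ U)
    {A : ℂ → E →L[ℂ] E} (hA : DifferentiableOn ℂ A U) (v : E) :
    ∃ Y : ℂ → E, Y z₀ = v ∧ ∀ z ∈ U, HasDerivAt Y (A z (Y z)) z := by
  choose! P hP0 hP using fun (g : ℂ → E) (hg : DifferentiableOn ℂ g U) =>
    exists_primitive_of_convex hU hc z₀ hg
  let Y : ℕ → ℂ → E := fun n => Nat.rec (fun _ => v) (fun _ g => P (fun z => A z (g z))) n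
  have hYd : ∀ n, DifferentiableOn ℂ (Y n) U := by
    intro n
    induction n with
    | zero => exact differentiableOn_const v
    | succ n ih =>
      exact fun z hz => (hP _ (hA.clm_apply ih) z hz).differentiableAt.differentiableWithinAt
  have hY0 : ∀ n, Y (n + 1) z₀ = 0 := fun n => hP0 _ (hA.clm_apply (hYd n))
  have hYs : ∀ n, ∀ z ∈ U, HasDerivAt (Y (n + 1)) (A z (Y n z)) z :=
    fun n => hP _ (hA.clm_apply (hYd n))
  have bound : ∀ (L : Set ℂ) (M : ℝ),
      (∀ w ∈ L, ∀ t ∈ Set.Icc (0 : ℝ) 1, z₀ + t • (w - z₀) ∈ L) → L ⊆ U → z₀ ∈ L → (∀ z ∈ L, ‖A z‖ ≤ M) →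
      ∀ n, ∀ z ∈ L, ‖Y n z‖ ≤ ‖v‖ * ((M * ‖z - z₀‖) ^ n / n.factorial) := by
    intro L M hL hLU hzL hM n
    have hM0 : 0 ≤ M := (norm_nonneg _).trans (hM z₀ hzL)
    induction n with
    | zero => intro z _; simp [Y]
    | succ n ih =>
      intro z hz
      have hγ : ∀ t ∈ Set.Icc (0 : ℝ) 1, z₀ + t * (z - z₀) ∈ L := by
        intro t ht
        have := hL z hz t ht
        simpa using this
      have hd : ∀ t ∈ Set.Icc (0 : ℝ) 1, HasDerivAt (fun t : ℝ => Y (n + 1) (z₀ + t * (z - z₀)))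
          ((z - z₀) • A (z₀ + t * (z - z₀)) (Y n (z₀ + t * (z - z₀)))) t := by
        intro t ht
        have h1 : HasDerivAt (fun t : ℝ => z₀ + t * (z - z₀)) (z - z₀) t := by
          simpa using ((Complex.ofRealCLM.hasDerivAt (x := t)).mul_const (z - z₀)).const_add z₀
        exact (hYs n _ (hLU (hγ t ht))).scomp t h1
      -- Integrating the bound for `Y n` along the segment from `z₀` to `z` produces the next factor
      -- `1 / (n + 1)`.
      have key := image_norm_le_of_norm_deriv_right_le_deriv_boundary
        (f := fun t : ℝ => Y (n + 1) (z₀ + t * (z - z₀))) (a := 0) (b := 1)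
        (B := fun t => ‖v‖ * ((M * ‖z - z₀‖) ^ (n + 1) / (n + 1).factorial) * t ^ (n + 1))
        (B' := fun t => ‖v‖ * ((M * ‖z - z₀‖) ^ (n + 1) / (n + 1).factorial) *
          (((n + 1 : ℕ) : ℝ) * t ^ n))
        (fun t ht => (hd t ht).continuousAt.continuousWithinAt)
        (fun t ht => (hd t (Set.Ico_subset_Icc_self ht)).hasDerivWithinAt)
        (by simp [hY0])
        (fun t => by simpa using (hasDerivAt_pow (n + 1) t).const_mul _)
        (by
          intro t ht
          have ht' := Set.Ico_subset_Icc_self ht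
          have h1 := ih _ (hγ t ht')
          have h2 := hM _ (hγ t ht')
          have h3 : ‖z₀ + (t : ℂ) * (z - z₀) - z₀‖ = t * ‖z - z₀‖ := by
            rw [add_sub_cancel_left, norm_mul, Complex.norm_real, Real.norm_of_nonneg ht.1]
          rw [h3] at h1
          calc _ ≤ ‖z - z₀‖ * (M * (‖v‖ * ((M * (t * ‖z - z₀‖)) ^ n / n.factorial))) := by
                rw [norm_smul]
                gcongr
                exact (ContinuousLinearMap.le_opNorm _ _).trans (by gcongr)
            _ = _ := by
                rw [Nat.factorial_succ]
                push_cast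
                have : (n.factorial : ℝ) ≠ 0 := by positivity
                have : (n + 1 : ℝ) ≠ 0 := by positivity
                field_simp
                ring)
      simpa using key (Set.right_mem_Icc.2 zero_le_one)
  refine ⟨fun z => ∑' n, Y n z, ?_, fun z hz => ?_⟩
  · refine tsum_eq_single 0 ?_
    intro n hn
    obtain ⟨m, rfl⟩ := Nat.exists_eq_succ_of_ne_zero hn
    exact hY0 m
  · obtain ⟨ε, hε, hball⟩ := Metric.isOpen_iff.1 hU z hz
    have hbU : Metric.closedBall z (ε / 2) ⊆ U :=
      (Metric.closedBall_subset_ball (by linarith)).trans hball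
    -- `L` is the cone over a closed ball with apex `z₀`: star-shaped, so `bound` applies, and
    -- compact, so `A` is bounded on it.
    let φ : ℝ × ℂ → ℂ := fun p => z₀ + p.1 • (p.2 - z₀)
    let L : Set ℂ := φ '' (Set.Icc 0 1 ×ˢ Metric.closedBall z (ε / 2))
    have hLU : L ⊆ U := by
      rintro _ ⟨⟨t, w⟩, ⟨ht, hw⟩, rfl⟩
      exact hc.add_smul_sub_mem hz₀ (hbU hw) ht
    have hLs : ∀ w ∈ L, ∀ t ∈ Set.Icc (0 : ℝ) 1, z₀ + t • (w - z₀) ∈ L := by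
      rintro _ ⟨⟨s, w⟩, ⟨hs, hw⟩, rfl⟩ t ht
      exact ⟨⟨t * s, w⟩, ⟨⟨mul_nonneg ht.1 hs.1, mul_le_one₀ ht.2 hs.1 hs.2⟩, hw⟩,
        by simp [φ, mul_assoc]⟩
    have hLc : IsCompact L :=
      (isCompact_Icc.prod (isCompact_closedBall z (ε / 2))).image (by fun_prop)
    obtain ⟨M, hM⟩ := hLc.exists_bound_of_continuousOn (hA.continuousOn.mono hLU)
    obtain ⟨D, hD⟩ := hLc.exists_bound_of_continuousOn (f := fun w => w - z₀) (by fun_prop)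
    have hzL : z₀ ∈ L :=
      ⟨⟨0, z⟩, ⟨⟨le_rfl, zero_le_one⟩, Metric.mem_closedBall_self (by linarith)⟩, by simp [φ]⟩
    have hbL : Metric.ball z (ε / 2) ⊆ L := fun w hw =>
      ⟨⟨1, w⟩, ⟨⟨zero_le_one, le_rfl⟩, Metric.ball_subset_closedBall hw⟩, by simp [φ]⟩
    have hM0 : 0 ≤ M := (norm_nonneg _).trans (hM z₀ hzL)
    have hb : ∀ n, ∀ w ∈ L, ‖Y n w‖ ≤ ‖v‖ * ((M * D) ^ n / n.factorial) := by
      intro n w hw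
      refine (bound L M hLs hLU hzL hM n w hw).trans ?_
      gcongr
      exact hD w hw
    have hsum : Summable fun n : ℕ => ‖v‖ * ((M * D) ^ n / n.factorial) :=
      (Real.summable_pow_div_factorial (M * D)).mul_left _
    have hzb : z ∈ Metric.ball z (ε / 2) := Metric.mem_ball_self (by linarith)
    have hYsum : Summable fun n => Y n z := .of_norm_bounded hsum fun n => hb n z (hbL hzb)
    have hder := hasDerivAt_tsum_of_isPreconnected (hsum.mul_left M) Metric.isOpen_ball
      (convex_ball z (ε / 2)).isPreconnected (g := fun n => Y (n + 1))
      (g' := fun n w => A w (Y n w)) (fun n w hw => hYs n w (hLU (hbL hw)))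
      (fun n w hw => (ContinuousLinearMap.le_opNorm _ _).trans (by
        have h1 := hM w (hbL hw)
        have h2 := hb n w (hbL hw)
        gcongr)) hzb ((summable_nat_add_iff 1).2 hYsum) hzb
    rw [← (A z).map_tsum hYsum] at hder
    refine (hder.const_add v).congr_of_eventuallyEq ?_
    filter_upwards [Metric.isOpen_ball.mem_nhds hzb] with w hw
    have : Summable fun n => Y n w := .of_norm_bounded hsum fun n => hb n w (hbL hw)
    exact this.tsum_eq_zero_add

theorem exists_second_order_linear_ode_solution {U : Set ℂ} (hU : IsOpen U) (hc : Convex ℝ U)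
    {z₀ : ℂ} (hz₀ : z₀ ∈ U) {Q : ℂ → ℂ} (hQ : DifferentiableOn ℂ Q U) (a b : ℂ) :
    ∃ u u' : ℂ → ℂ, u z₀ = a ∧ u' z₀ = b ∧
      ∀ z ∈ U, HasDerivAt u (u' z) z ∧ HasDerivAt u' (Q z * u z) z := by
  let A : ℂ → (ℂ × ℂ) →L[ℂ] (ℂ × ℂ) := fun z =>
    (ContinuousLinearMap.inl ℂ ℂ ℂ).comp (ContinuousLinearMap.snd ℂ ℂ ℂ) +
      Q z • (ContinuousLinearMap.inr ℂ ℂ ℂ).comp (ContinuousLinearMap.fst ℂ ℂ ℂ)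
  have hA : DifferentiableOn ℂ A U := (hQ.smul_const _).const_add _
  obtain ⟨Y, hY0, hY⟩ := exists_linear_ode_solution hU hc hz₀ hA (a, b)
  refine ⟨fun z => (Y z).1, fun z => (Y z).2, by simp [hY0], by simp [hY0], fun z hz => ?_⟩
  constructor
  · exact ((hasFDerivAt_fst (𝕜 := ℂ) (p := Y z)).comp_hasDerivAt z (hY z hz)).congr_deriv
      (by simp [A])
  · exact ((hasFDerivAt_snd (𝕜 := ℂ) (p := Y z)).comp_hasDerivAt z (hY z hz)).congr_deriv
      (by simp [A])

/-! ### Bounded solutions of the Riccati equation on the line -/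

section Riccati

open MeasureTheory BoundedContinuousFunction

theorem integrableOn_exp_mul_bounded (h : ℝ →ᵇ ℂ) (s : ℝ) :
    IntegrableOn (fun t : ℝ => Complex.exp t * h t) (Set.Iic s) := by
  have : IntegrableOn (fun t : ℝ => Real.exp t * ‖h‖) (Set.Iic s) :=
    (integrableOn_exp_Iic s).mul_const _
  refine this.mono' ?_ ?_
  · exact (by fun_prop : Continuous fun t : ℝ => Complex.exp t * h t).aestronglyMeasurable
  · refine Filter.Eventually.of_forall fun t => ?_
    rw [norm_mul, Complex.norm_exp, Complex.ofReal_re]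
    gcongr
    exact h.norm_coe_le_norm t

/-- The bounded solution of `y' = h - y`, as a function on the line. -/
noncomputable def dampedPrimitive (h : ℝ →ᵇ ℂ) (s : ℝ) : ℂ :=
  Complex.exp (-s) * ∫ t in Set.Iic s, Complex.exp t * h t

theorem hasDerivAt_dampedPrimitive (h : ℝ →ᵇ ℂ) (s : ℝ) :
    HasDerivAt (dampedPrimitive h) (h s - dampedPrimitive h s) s := by
  have hc : Continuous fun t : ℝ => Complex.exp t * h t := by fun_prop
  have h1 : HasDerivAt (fun s : ℝ => ∫ t in Set.Iic s, Complex.exp t * h t)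
      (Complex.exp s * h s) s := by
    have h2 : (fun s : ℝ => ∫ t in Set.Iic s, Complex.exp t * h t) = fun s : ℝ =>
        (∫ t in Set.Iic (0 : ℝ), Complex.exp t * h t) + ∫ t in (0 : ℝ)..s, Complex.exp t * h t := by
      ext s
      rw [← intervalIntegral.integral_Iic_sub_Iic (integrableOn_exp_mul_bounded h 0)
        (integrableOn_exp_mul_bounded h s)]
      ring
    rw [h2]
    exact (intervalIntegral.integral_hasDerivAt_right (hc.intervalIntegrable _ _)
      (hc.stronglyMeasurableAtFilter _ _) hc.continuousAt).const_add _
  have h3 : HasDerivAt (fun s : ℝ => Complex.exp (-s)) (-Complex.exp (-s)) s := by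
    simpa using (Complex.ofRealCLM.hasDerivAt (x := s)).neg.cexp
  have h4 := h3.mul h1
  refine h4.congr_deriv ?_
  have : Complex.exp (-s) * Complex.exp s = 1 := by rw [← Complex.exp_add]; simp
  unfold dampedPrimitive
  linear_combination h s * this

/-- The value at `s` is an average of `h`: the weight `exp (t - s)` has mass `1` on `(-∞, s]`. -/
theorem norm_dampedPrimitive_le (h : ℝ →ᵇ ℂ) (s : ℝ) : ‖dampedPrimitive h s‖ ≤ ‖h‖ := by
  have h1 : ‖∫ t in Set.Iic s, Complex.exp t * h t‖ ≤ ∫ t in Set.Iic s, Real.exp t * ‖h‖ := by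
    refine norm_integral_le_of_norm_le ((integrableOn_exp_Iic s).mul_const _) ?_
    refine Filter.Eventually.of_forall fun t => ?_
    rw [norm_mul, Complex.norm_exp, Complex.ofReal_re]
    gcongr
    exact h.norm_coe_le_norm t
  rw [integral_mul_const, integral_exp_Iic] at h1
  unfold dampedPrimitive
  rw [norm_mul, Complex.norm_exp]
  calc _ ≤ Real.exp (-(s : ℂ)).re * (Real.exp s * ‖h‖) := by gcongr
    _ = ‖h‖ := by
      rw [← mul_assoc, ← Real.exp_add]
      simp

theorem dampedPrimitive_sub (h k : ℝ →ᵇ ℂ) (s : ℝ) :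
    dampedPrimitive (h - k) s = dampedPrimitive h s - dampedPrimitive k s := by
  unfold dampedPrimitive
  rw [← mul_sub, ← integral_sub (integrableOn_exp_mul_bounded h s)
    (integrableOn_exp_mul_bounded k s)]
  simp [mul_sub]

/-- A Riccati equation with small coefficient has a small solution on the whole line. -/
theorem exists_bounded_riccati_solution {q : ℝ → ℂ} (hq : Continuous q) {K : ℝ} (hK : K < 1 / 2)
    (hqK : ∀ s, ‖q s‖ ≤ K) :
    ∃ e : ℝ → ℂ, (∀ s, HasDerivAt e (-e s - e s ^ 2 - q s / 2) s) ∧ ∀ s, ‖e s‖ ≤ K := by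
  have hK0 : 0 ≤ K := (norm_nonneg _).trans (hqK 0)
  let g : ℝ →ᵇ ℂ := .ofNormedAddCommGroup (fun s => q s / 2) (by fun_prop) (K / 2)
    (fun s => by simpa using div_le_div_of_nonneg_right (hqK s) zero_le_two)
  have hg : ‖g‖ ≤ K / 2 := BoundedContinuousFunction.norm_ofNormedAddCommGroup_le (by fun_prop)
    (by positivity) _
  -- A fixed point of `T` solves `e' = (-e² - q/2) - e`. The ball of radius `K` is preserved because
  -- `K² + K/2 ≤ K`.
  let T : (ℝ →ᵇ ℂ) → (ℝ →ᵇ ℂ) := fun e => .ofNormedAddCommGroup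
    (dampedPrimitive (-(e * e) - g))
    (continuous_iff_continuousAt.2 fun s => (hasDerivAt_dampedPrimitive _ s).continuousAt)
    _ (norm_dampedPrimitive_le _)
  let B : Set (ℝ →ᵇ ℂ) := Metric.closedBall 0 K
  have hT : Set.MapsTo T B B := by
    intro e he
    have he : ‖e‖ ≤ K := mem_closedBall_zero_iff.1 he
    refine mem_closedBall_zero_iff.2 ?_
    refine (BoundedContinuousFunction.norm_le hK0).2 fun s => ?_
    refine (norm_dampedPrimitive_le _ s).trans ((norm_sub_le _ _).trans ?_)
    rw [norm_neg]
    have := norm_mul_le e e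
    nlinarith [norm_nonneg e]
  have hlip : ContractingWith (2 * K).toNNReal (hT.restrict T B B) := by
    refine ⟨by rw [Real.toNNReal_lt_one]; linarith, ?_⟩
    refine LipschitzWith.of_dist_le_mul fun x y => ?_
    rw [Subtype.dist_eq, Subtype.dist_eq, dist_eq_norm, dist_eq_norm]
    have hx : ‖x.1‖ ≤ K := mem_closedBall_zero_iff.1 x.2
    have hy : ‖y.1‖ ≤ K := mem_closedBall_zero_iff.1 y.2
    rw [Real.coe_toNNReal _ (by positivity)]
    refine (BoundedContinuousFunction.norm_le (by positivity)).2 fun s => ?_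
    have h1 : (T x.1 - T y.1) s = dampedPrimitive ((-(x.1 * x.1) - g) - (-(y.1 * y.1) - g)) s :=
      (dampedPrimitive_sub _ _ s).symm
    -- Factoring the difference of squares gives the Lipschitz constant `2K < 1`.
    have h2 : (-(x.1 * x.1) - g) - (-(y.1 * y.1) - g) = -((x.1 + y.1) * (x.1 - y.1)) := by ring
    have h3 : ‖x.1 + y.1‖ ≤ 2 * K := (norm_add_le _ _).trans (by linarith)
    change ‖(T x.1 - T y.1) s‖ ≤ _
    rw [h1, h2]
    refine (norm_dampedPrimitive_le _ s).trans ?_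
    rw [norm_neg]
    exact (norm_mul_le _ _).trans (by gcongr)
  have h0 : (0 : ℝ →ᵇ ℂ) ∈ B := Metric.mem_closedBall_self hK0
  obtain ⟨e, heB, hfix, -⟩ := hlip.exists_fixedPoint' Metric.isClosed_closedBall.isComplete hT h0
    (edist_ne_top _ _)
  refine ⟨e, fun s => ?_, fun s => (e.norm_coe_le_norm s).trans (mem_closedBall_zero_iff.1 heB)⟩
  have h1 : (e : ℝ → ℂ) = dampedPrimitive (-(e * e) - g) := (congrArg DFunLike.coe hfix).symm
  have h2 := hasDerivAt_dampedPrimitive (-(e * e) - g) s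
  rw [← h1] at h2
  refine h2.congr_deriv ?_
  simp [g]
  ring

/-- The unique solution of a scalar linear equation `y' = a y`. -/
theorem eq_mul_exp_of_hasDerivAt_mul {a y : ℝ → ℂ} (ha : Continuous a)
    (hy : ∀ s, HasDerivAt y (a s * y s) s) (s : ℝ) :
    y s = y 0 * Complex.exp (∫ t in (0 : ℝ)..s, a t) := by
  have hI : ∀ s, HasDerivAt (fun s => ∫ t in (0 : ℝ)..s, a t) (a s) s := fun s =>
    intervalIntegral.integral_hasDerivAt_right (ha.intervalIntegrable _ _)
      (ha.stronglyMeasurableAtFilter _ _) ha.continuousAt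
  have hd : ∀ s, HasDerivAt (fun s => y s * Complex.exp (-∫ t in (0 : ℝ)..s, a t)) 0 s := by
    intro s
    refine ((hy s).mul (hI s).neg.cexp).congr_deriv ?_
    ring
  have h1 := is_const_of_deriv_eq_zero (fun s => (hd s).differentiableAt)
    (fun s => (hd s).deriv) s 0
  simp only [intervalIntegral.integral_same, neg_zero, Complex.exp_zero, mul_one] at h1
  rw [← h1, mul_assoc, ← Complex.exp_add]
  simp

/-- If `m` solves the Riccati equation of `y'' = b y' + c y`, and `y'(0) = m(0) y(0)`, then `m`
is the logarithmic derivative of `y`. -/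
theorem eq_mul_exp_of_riccati {b c m y y' : ℝ → ℂ} (hb : Continuous b)
    (hm : ∀ s, HasDerivAt m (b s * m s + c s - m s ^ 2) s)
    (hy : ∀ s, HasDerivAt y (y' s) s) (hy' : ∀ s, HasDerivAt y' (b s * y' s + c s * y s) s)
    (h0 : y' 0 = m 0 * y 0) (s : ℝ) :
    y s = y 0 * Complex.exp (∫ t in (0 : ℝ)..s, m t) := by
  have hmc : Continuous m := continuous_iff_continuousAt.2 fun s => (hm s).continuousAt
  -- The defect `y' - m y` solves a homogeneous first-order equation and vanishes at `0`, hence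
  -- everywhere.
  have hw : ∀ s, HasDerivAt (fun s => y' s - m s * y s) ((b s - m s) * (y' s - m s * y s)) s := by
    intro s
    refine ((hy' s).sub ((hm s).mul (hy s))).congr_deriv ?_
    ring
  have h1 : ∀ s, y' s = m s * y s := by
    intro s
    have := eq_mul_exp_of_hasDerivAt_mul (hb.sub hmc) hw s
    rw [h0, sub_self, zero_mul] at this
    exact sub_eq_zero.1 this
  exact eq_mul_exp_of_hasDerivAt_mul hmc (fun s => h1 s ▸ hy s) s

end Riccati

/-! ### Quotients of solutions as maps to the sphere -/

namespace HalfPlane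

/-- The quotient `A / B` of two functions without common zeros, as a map to the sphere. -/
noncomputable def sphereQuotient (A B : ℂ → ℂ) (z : ℍ) : OnePoint ℂ :=
  open Classical in if B z = 0 then ∞ else ((A z / B z : ℂ) : OnePoint ℂ)

theorem eventually_coe_ofComplex (z : ℍ) :
    ∀ᶠ w in 𝓝 (z : ℂ), (UpperHalfPlane.ofComplex w : ℂ) = w :=
  UpperHalfPlane.eventuallyEq_coe_comp_ofComplex z.im_pos

theorem localRep_sphereQuotient_of_ne_zero {A B : ℂ → ℂ} {z : ℍ} (hB : ContinuousAt B z)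
    (hz : B z ≠ 0) : localRep (sphereQuotient A B) z =ᶠ[𝓝 (z : ℂ)] fun w => A w / B w := by
  filter_upwards [hB.eventually_ne hz, eventually_coe_ofComplex z] with w hw hw'
  simp [localRep, sphereQuotient, hz, hw, hw', sphereChart]

theorem localRep_sphereQuotient_of_eq_zero {A B : ℂ → ℂ} {z : ℍ} (hz : B z = 0) :
    localRep (sphereQuotient A B) z =ᶠ[𝓝 (z : ℂ)] fun w => B w / A w := by
  filter_upwards [eventually_coe_ofComplex z] with w hw'
  by_cases hw : B w = 0 <;> simp [localRep, sphereQuotient, hz, hw, hw', sphereChart]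

theorem continuous_sphereQuotient {A B : ℂ → ℂ} (hA : ∀ z : ℍ, ContinuousAt A z)
    (hB : ∀ z : ℍ, ContinuousAt B z) (h : ∀ z : ℍ, B z = 0 → A z ≠ 0) :
    Continuous (sphereQuotient A B) := by
  refine continuous_iff_continuousAt.2 fun z => ?_
  have hA' : ContinuousAt (fun w : ℍ => A w) z :=
    (hA z).comp UpperHalfPlane.continuous_coe.continuousAt
  have hB' : ContinuousAt (fun w : ℍ => B w) z :=
    (hB z).comp UpperHalfPlane.continuous_coe.continuousAt
  by_cases hz : B z = 0
  · have hfz : sphereQuotient A B z = ∞ := by simp [sphereQuotient, hz]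
    unfold ContinuousAt
    rw [hfz]
    refine Filter.Tendsto.if tendsto_const_nhds ?_
    refine OnePoint.tendsto_coe_infty.comp ?_
    rw [Filter.coclosedCompact_eq_cocompact, ← Metric.cobounded_eq_cocompact]
    -- Near a pole, off the zeros of `B`, the reciprocal `B / A` tends to `0` through nonzero
    -- values, so `A / B` tends to `∞`.
    have h1 : Filter.Tendsto (fun w : ℍ => B w / A w)
        (𝓝 z ⊓ Filter.principal {w : ℍ | ¬ B w = 0}) (𝓝[≠] 0) := by
      refine tendsto_nhdsWithin_iff.2 ⟨?_, ?_⟩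
      · have := hB'.div hA' (h z hz)
        unfold ContinuousAt at this
        simp only [Pi.div_apply, hz, zero_div] at this
        exact this.mono_left inf_le_left
      · have h2 : ∀ᶠ w : ℍ in 𝓝 z, A w ≠ 0 := hA'.eventually_ne (h z hz)
        rw [Filter.eventually_inf_principal]
        filter_upwards [h2] with w hw hw'
        exact div_ne_zero hw' hw
    simpa [Function.comp_def] using Filter.tendsto_inv₀_nhdsNE_zero.comp h1
  · have h1 : ContinuousAt (fun w : ℍ => ((A w / B w : ℂ) : OnePoint ℂ)) z :=
      OnePoint.continuous_coe.continuousAt.comp (hA'.div hB' hz)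
    refine h1.congr ?_
    filter_upwards [hB'.eventually_ne hz] with w hw
    simp [sphereQuotient, hw]

theorem exists_injOn_of_deriv_localRep_ne_zero {f : ℍ → OnePoint ℂ} {z : ℍ}
    (ha : AnalyticAt ℂ (localRep f z) z) (hd : deriv (localRep f z) z ≠ 0) :
    ∃ U ∈ 𝓝 z, Set.InjOn f U := by
  have h1 : HasStrictDerivAt (localRep f z) (deriv (localRep f z) z) z := ha.hasStrictDerivAt
  obtain ⟨V, hV, hinj⟩ : ∃ V ∈ 𝓝 (z : ℂ), Set.InjOn (localRep f z) V := by
    have h2 := h1.hasStrictFDerivAt_equiv hd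
    exact ⟨_, (h2.toOpenPartialHomeomorph _).open_source.mem_nhds
      h2.mem_toOpenPartialHomeomorph_source, (h2.toOpenPartialHomeomorph _).injOn⟩
  refine ⟨(↑) ⁻¹' V, UpperHalfPlane.continuous_coe.continuousAt.preimage_mem_nhds hV, ?_⟩
  intro a ha b hb hab
  refine UpperHalfPlane.ext ?_
  refine hinj ha hb ?_
  simp only [localRep, UpperHalfPlane.ofComplex_apply, hab]

/-- `u` is a solution of `u'' = Q u` on `U`, with derivative `u'`. -/
structure IsLinearSolution (Q : ℂ → ℂ) (U : Set ℂ) (u u' : ℂ → ℂ) : Prop where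
  hasDerivAt : ∀ z ∈ U, HasDerivAt u (u' z) z
  hasDerivAt' : ∀ z ∈ U, HasDerivAt u' (Q z * u z) z

variable {Q A A' B B' : ℂ → ℂ} {U : Set ℂ}

theorem IsLinearSolution.wronskian_eq (hU : IsOpen U) (hUc : IsPreconnected U)
    (hA : IsLinearSolution Q U A A') (hB : IsLinearSolution Q U B B') {z w : ℂ} (hz : z ∈ U)
    (hw : w ∈ U) : A' z * B z - A z * B' z = A' w * B w - A w * B' w := by
  have hd : ∀ z ∈ U, HasDerivAt (fun z => A' z * B z - A z * B' z) 0 z := fun z hz =>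
    (((hA.2 z hz).mul (hB.1 z hz)).sub ((hA.1 z hz).mul (hB.2 z hz))).congr_deriv (by ring)
  exact hU.is_const_of_deriv_eq_zero hUc
    (fun z hz => (hd z hz).differentiableAt.differentiableWithinAt)
    (fun z hz => (hd z hz).deriv) hz hw

/-- Since `(A / B)' = W / B²`, the logarithmic derivative of `g'` is `-2 B' / B`; in the Schwarzian
the `B'²` terms cancel and `-2 B'' / B = -2 Q` remains. -/
theorem IsLinearSolution.quotient (hU : IsOpen U) (hA : IsLinearSolution Q U A A')
    (hB : IsLinearSolution Q U B B') {W : ℂ} (hW : W ≠ 0)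
    (hAB : ∀ z ∈ U, A' z * B z - A z * B' z = W) {z : ℂ} (hz : z ∈ U) (hBz : B z ≠ 0)
    {g : ℂ → ℂ} (hg : g =ᶠ[𝓝 z] fun w => A w / B w) :
    AnalyticAt ℂ g z ∧ deriv g z = W / B z ^ 2 ∧ schwarzian g z = -2 * Q z := by
  have hev : ∀ᶠ w in 𝓝 z, w ∈ U ∧ B w ≠ 0 :=
    Filter.Eventually.and (hU.mem_nhds hz) ((hB.1 z hz).continuousAt.eventually_ne hBz)
  have hd : ∀ w, w ∈ U ∧ B w ≠ 0 → HasDerivAt (fun w => A w / B w) (W / B w ^ 2) w :=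
    fun w hw => ((hA.1 w hw.1).div (hB.1 w hw.1) hw.2).congr_deriv (by rw [hAB w hw.1])
  have hg' : deriv g =ᶠ[𝓝 z] fun w => W / B w ^ 2 := by
    filter_upwards [hg.eventuallyEq_nhds, hev] with w hw hw'
    rw [hw.deriv_eq, (hd w hw').deriv]
  have hd2 : ∀ w, w ∈ U ∧ B w ≠ 0 →
      HasDerivAt (fun w => W / B w ^ 2) (-2 * W * B' w / B w ^ 3) w := by
    intro w hw
    refine ((hasDerivAt_const w W).div ((hB.1 w hw.1).pow 2) (pow_ne_zero 2 hw.2)).congr_deriv ?_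
    have := hw.2
    simp
    field_simp
  have hlog : logDeriv (deriv g) =ᶠ[𝓝 z] fun w => -2 * B' w / B w := by
    filter_upwards [hg'.eventuallyEq_nhds, hev] with w hw hw'
    rw [logDeriv_apply, hw.deriv_eq, (hd2 w hw').deriv, hw.eq_of_nhds]
    have := hw'.2
    field_simp
  have hd3 : HasDerivAt (fun w => -2 * B' w / B w)
      ((-2 * (Q z * B z) * B z - -2 * B' z * B' z) / B z ^ 2) z :=
    ((hB.2 z hz).const_mul (-2)).div (hB.1 z hz) hBz
  refine ⟨?_, hg'.eq_of_nhds, ?_⟩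
  · have : AnalyticAt ℂ (fun w => A w / B w) z :=
      Complex.analyticAt_iff_eventually_differentiableAt.2
        (hev.mono fun w hw => (hd w hw).differentiableAt)
    exact this.congr hg.symm
  · rw [schwarzian, hlog.deriv_eq, hlog.eq_of_nhds, hd3.deriv]
    field_simp
    ring

/-- A quotient of two independent solutions of `u'' = Q u` is locally univalent and has
Schwarzian derivative `-2 Q`. -/
theorem IsLinearSolution.sphereQuotient
    (hA : IsLinearSolution Q {z | 0 < z.im} A A') (hB : IsLinearSolution Q {z | 0 < z.im} B B')
    {W : ℂ} (hW : W ≠ 0) (hAB : ∀ z : ℂ, 0 < z.im → A' z * B z - A z * B' z = W) :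
    IsLocallyUnivalent (sphereQuotient A B) ∧
      (∀ z : ℍ, sphereSchwarzian (HalfPlane.sphereQuotient A B) z = -2 * Q z) ∧
      ∀ z : ℍ, B z ≠ 0 → sphereDeriv (HalfPlane.sphereQuotient A B) z = W / B z ^ 2 := by
  have hU : IsOpen {z : ℂ | 0 < z.im} := isOpen_lt continuous_const Complex.continuous_im
  have hne : ∀ z : ℍ, B z = 0 → A z ≠ 0 := by
    intro z hz hz'
    have := hAB z z.im_pos
    simp [hz, hz'] at this
    exact hW this.symm
  have hBA : ∀ z : ℂ, 0 < z.im → B' z * A z - B z * A' z = -W := fun z hz => by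
    rw [← hAB z hz]
    ring
  have h1 : ∀ z : ℍ, B z ≠ 0 → _ := fun z hz =>
    hA.quotient hU hB hW hAB z.im_pos hz
      (localRep_sphereQuotient_of_ne_zero (A := A) (hB.1 z z.im_pos).continuousAt hz)
  have h2 : ∀ z : ℍ, B z = 0 → _ := fun z hz =>
    hB.quotient hU hA (neg_ne_zero.2 hW) hBA z.im_pos (hne z hz)
      (localRep_sphereQuotient_of_eq_zero (A := A) hz)
  have han : ∀ z : ℍ, AnalyticAt ℂ (localRep (HalfPlane.sphereQuotient A B) z) z := fun z => by
    by_cases hz : B z = 0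
    exacts [(h2 z hz).1, (h1 z hz).1]
  refine ⟨⟨⟨continuous_sphereQuotient (fun z => (hA.1 z z.im_pos).continuousAt)
    (fun z => (hB.1 z z.im_pos).continuousAt) hne, han⟩, fun z => ?_⟩, fun z => ?_,
    fun z hz => (h1 z hz).2.1⟩
  · refine exists_injOn_of_deriv_localRep_ne_zero (han z) ?_
    by_cases hz : B z = 0
    · rw [(h2 z hz).2.1]
      exact div_ne_zero (neg_ne_zero.2 hW) (pow_ne_zero 2 (hne z hz))
    · rw [(h1 z hz).2.1]
      exact div_ne_zero hW (pow_ne_zero 2 hz)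
  · by_cases hz : B z = 0
    exacts [(h2 z hz).2.2, (h1 z hz).2.2]

end HalfPlane

/-! ### Behaviour along the imaginary axis -/

namespace HalfPlane

theorem mem_thickening_imaginaryAxis {z : ℍ} (hz : z.re = 0) {r : ℝ} (hr : 0 < r) :
    z ∈ Metric.thickening r imaginaryAxis :=
  Metric.self_subset_thickening hr _ hz

/-- A solution on the imaginary axis of `u'' = Q u`, in terms of a solution of the corresponding
Riccati equation in the coordinate `s ↦ i eˢ`. -/
theorem IsLinearSolution.apply_exp_mul_I {Q u u' : ℂ → ℂ}
    (hu : IsLinearSolution Q {z | 0 < z.im} u u') {m : ℝ → ℂ}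
    (hm : ∀ s : ℝ, HasDerivAt m
      (m s + (Complex.exp s * Complex.I) ^ 2 * Q (Complex.exp s * Complex.I) - m s ^ 2) s)
    (h0 : Complex.I * u' Complex.I = m 0 * u Complex.I) (s : ℝ) :
    u (Complex.exp s * Complex.I) = u Complex.I * Complex.exp (∫ t in (0 : ℝ)..s, m t) := by
  let γ : ℝ → ℂ := fun s => Complex.exp s * Complex.I
  have hγ : ∀ s, HasDerivAt γ (γ s) s := fun s => by
    simpa [γ] using (Complex.ofRealCLM.hasDerivAt (x := s)).cexp.mul_const Complex.I
  have him : ∀ s, 0 < (γ s).im := fun s => by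
    simp [γ, ← Complex.ofReal_exp, Real.exp_pos]
  have h := eq_mul_exp_of_riccati (b := fun _ => 1) (c := fun s => γ s ^ 2 * Q (γ s)) (m := m)
    (y := fun s => u (γ s)) (y' := fun s => γ s * u' (γ s)) continuous_const
    (fun s => (hm s).congr_deriv (by simp [γ]))
    (fun s => (hu.hasDerivAt _ (him s)).scomp s (hγ s))
    (fun s => ((hγ s).mul ((hu.hasDerivAt' _ (him s)).scomp s (hγ s))).congr_deriv
      (by simp only [smul_eq_mul, one_mul, Function.comp_apply]; ring))
    (by simpa [γ] using h0) s
  simpa [γ] using h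

theorem norm_exp_integral_one_add {m : ℝ → ℂ} (hm : Continuous m) {C : ℝ}
    (hC : ∀ s, ‖m s‖ ≤ C) (s : ℝ) :
    Real.exp (s - C * |s|) ≤ ‖Complex.exp (∫ t in (0 : ℝ)..s, (1 + m t))‖ ∧
      ‖Complex.exp (∫ t in (0 : ℝ)..s, (1 + m t))‖ ≤ Real.exp (s + C * |s|) := by
  have h1 : (∫ t in (0 : ℝ)..s, (1 + m t)) = s + ∫ t in (0 : ℝ)..s, m t := by
    rw [intervalIntegral.integral_add (by simp) (hm.intervalIntegrable _ _)]
    simp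
  have h2 : ‖∫ t in (0 : ℝ)..s, m t‖ ≤ C * |s| := by
    simpa using intervalIntegral.norm_integral_le_of_norm_le_const (a := 0) (b := s)
      (f := m) (C := C) fun x _ => hC x
  have h3 := abs_le.1 ((Complex.abs_re_le_norm _).trans h2)
  rw [Complex.norm_exp, h1, Complex.add_re, Complex.ofReal_re]
  constructor <;> gcongr <;> linarith

theorem tendsto_coe_infty_of_norm {α : Type*} {l : Filter α} {g : α → ℂ}
    (hg : Filter.Tendsto (fun t => ‖g t‖) l Filter.atTop) :
    Filter.Tendsto (fun t => (g t : OnePoint ℂ)) l (𝓝 ∞) := by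
  refine OnePoint.tendsto_coe_infty.comp ?_
  rwa [Filter.coclosedCompact_eq_cocompact, ← Metric.cobounded_eq_cocompact,
    ← tendsto_norm_atTop_iff_cobounded]

theorem norm_sub_one_le_and_norm_inv_sub_one_le {x y : ℂ} {K r : ℝ} (hr : 0 < r)
    (hr' : r < 1 / 2) (hKr : K / r < 1 / 4) (hx : ‖x‖ ≤ K) (hy : ‖y‖ ≤ K) :
    ‖(1 + x - y) - 1‖ ≤ 9 * K / r ∧ ‖1 / (1 + x - y) - 1‖ ≤ 9 * K / r := by
  have hK0 : 0 ≤ K := (norm_nonneg x).trans hx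
  have hK : K < 1 / 8 := by
    rw [div_lt_iff₀ hr] at hKr
    linarith
  have h1 : ‖(1 + x - y) - 1‖ ≤ 2 * K := by
    rw [show (1 + x - y) - 1 = x - y by ring]
    exact (norm_sub_le _ _).trans (by linarith)
  have h2 : 3 / 4 ≤ ‖1 + x - y‖ := by
    have := norm_sub_norm_le (1 : ℂ) (1 - (1 + x - y))
    rw [norm_sub_rev 1, norm_one, sub_sub_cancel] at this
    linarith
  have h3 : 9 * K ≤ 9 * K / r := by
    rw [le_div_iff₀ hr]
    nlinarith
  refine ⟨by linarith, ?_⟩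
  have h4 : (1 + x - y) ≠ 0 := norm_pos_iff.1 (by linarith)
  rw [div_sub_one h4, norm_div, norm_sub_rev, div_le_iff₀ (by linarith)]
  nlinarith

end HalfPlane

/-! ### Choice of the two solutions and the main theorem -/

theorem theorem3p1 (Φ : ℍ → ℂ) (hΦ : MDifferentiable 𝓘(ℂ) 𝓘(ℂ) Φ) (K r : ℝ)
    (hr_pos : 0 < r) (hr : r < 1 / 2) (hKr : K / r < 1 / 4)
    (hbound : ∀ z ∈ Metric.thickening r HalfPlane.imaginaryAxis, HalfPlane.quadNorm Φ z ≤ K) :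
    ∃ f : ℍ → OnePoint ℂ,
      HalfPlane.IsLocallyUnivalent f ∧
      (∀ z : ℍ, HalfPlane.sphereSchwarzian f z = Φ z) ∧
      Filter.Tendsto (fun t : ℝ => f (UpperHalfPlane.ofComplex (t * Complex.I)))
        (𝓝[>] 0) (𝓝 ((0 : ℂ) : OnePoint ℂ)) ∧
      Filter.Tendsto (fun t : ℝ => f (UpperHalfPlane.ofComplex (t * Complex.I)))
        Filter.atTop (𝓝 ∞) ∧
      f UpperHalfPlane.I = (Complex.I : OnePoint ℂ) ∧
      ‖HalfPlane.sphereDeriv f UpperHalfPlane.I - 1‖ ≤ 9 * K / r ∧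
      ‖1 / HalfPlane.sphereDeriv f UpperHalfPlane.I - 1‖ ≤ 9 * K / r := by
  have hK : K < 1 / 8 := by
    rw [div_lt_iff₀ hr_pos] at hKr
    linarith
  let U : Set ℂ := {z | 0 < z.im}
  have hU : IsOpen U := UpperHalfPlane.isOpen_upperHalfPlaneSet
  have hUc : Convex ℝ U := convex_halfSpace_im_gt 0
  have hI : Complex.I ∈ U := by simp [U]
  let Q : ℂ → ℂ := fun z => -(1 / 2) * Φ (UpperHalfPlane.ofComplex z)
  have hΦ' : DifferentiableOn ℂ (fun z => Φ (UpperHalfPlane.ofComplex z)) U :=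
    UpperHalfPlane.mdifferentiable_iff.1 hΦ
  have hQ : DifferentiableOn ℂ Q U := hΦ'.const_mul _
  let γ : ℝ → ℂ := fun s => Complex.exp s * Complex.I
  have hγim : ∀ s, (γ s).im = Real.exp s := fun s => by simp [γ, ← Complex.ofReal_exp]
  have hγU : ∀ s, γ s ∈ U := fun s => (Real.exp_pos s).trans_eq (hγim s).symm
  let q : ℝ → ℂ := fun s => γ s ^ 2 * Φ (UpperHalfPlane.ofComplex (γ s))
  have hqc : Continuous q := by
    have h1 : Continuous γ := by fun_prop
    exact (h1.pow 2).mul (hΦ'.continuousOn.comp_continuous h1 hγU)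
  have hqK : ∀ s, ‖q s‖ ≤ K := by
    intro s
    have h1 : (UpperHalfPlane.ofComplex (γ s) : ℂ) = γ s := by
      rw [UpperHalfPlane.ofComplex_apply_of_im_pos (hγU s)]
    have h2 : (UpperHalfPlane.ofComplex (γ s)).im = Real.exp s := by
      rw [← UpperHalfPlane.coe_im, h1, hγim]
    have h3 := hbound (UpperHalfPlane.ofComplex (γ s))
      (HalfPlane.mem_thickening_imaginaryAxis (by
        rw [← UpperHalfPlane.coe_re, h1]
        simp [γ, ← Complex.ofReal_exp]) hr_pos)
    rw [HalfPlane.quadNorm, h2] at h3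
    simpa [q, γ, Complex.norm_exp] using h3
  obtain ⟨e, he, heK⟩ := exists_bounded_riccati_solution hqc (by linarith) hqK
  -- The equilibrium `0` of `m' = m - m²` is repelling; reversing time makes it attracting, and
  -- `m(s) = -d(-s)` turns the equation near `0` into the one solved for `e`.
  obtain ⟨d, hd, hdK⟩ := exists_bounded_riccati_solution (q := fun s => q (-s)) (by fun_prop)
    (by linarith) fun s => hqK (-s)
  have hec : Continuous e := continuous_iff_continuousAt.2 fun s => (he s).continuousAt
  have hdc : Continuous d := continuous_iff_continuousAt.2 fun s => (hd s).continuousAt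
  -- The initial slopes are dictated by `i u'(i) = m(0) u(i)`, with `m(0) = 1 + e 0` for `A` and
  -- `m(0) = -d 0` for `B`.
  obtain ⟨A, A', hA0, hA'0, hA⟩ := exists_second_order_linear_ode_solution hU hUc hI hQ
    Complex.I (1 + e 0)
  obtain ⟨B, B', hB0, hB'0, hB⟩ := exists_second_order_linear_ode_solution hU hUc hI hQ
    1 (Complex.I * d 0)
  have hA : HalfPlane.IsLinearSolution Q U A A' :=
    ⟨fun z hz => (hA z hz).1, fun z hz => (hA z hz).2⟩
  have hB : HalfPlane.IsLinearSolution Q U B B' :=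
    ⟨fun z hz => (hB z hz).1, fun z hz => (hB z hz).2⟩
  have hγQ : ∀ s, γ s ^ 2 * Q (γ s) = -q s / 2 := fun s => by simp only [Q, q]; ring
  have hAγ : ∀ s, A (γ s) = Complex.I * Complex.exp (∫ t in (0 : ℝ)..s, (1 + e t)) := by
    intro s
    rw [← hA0]
    refine hA.apply_exp_mul_I (fun s => ((he s).const_add 1).congr_deriv ?_)
      (by rw [hA0, hA'0]; ring) s
    linear_combination -hγQ s
  have hBγ : ∀ s, B (γ s) = Complex.exp (∫ t in (0 : ℝ)..s, -d (-t)) := by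
    intro s
    rw [← one_mul (Complex.exp _), ← hB0]
    refine hB.apply_exp_mul_I (fun s => ?_)
      (by rw [hB0, hB'0, ← mul_assoc, Complex.I_mul_I]; simp) s
    have h1 := ((hd (-s)).scomp s (hasDerivAt_neg s)).neg
    refine h1.congr_deriv ?_
    simp only [neg_neg, neg_smul, one_smul]
    linear_combination -hγQ s
  have hdcn : Continuous fun t => d (-t) := hdc.comp continuous_neg
  have hABγ : ∀ s, A (γ s) / B (γ s) =
      Complex.I * Complex.exp (∫ t in (0 : ℝ)..s, (1 + (e t + d (-t)))) := by
    intro s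
    have h1 : (∫ t in (0 : ℝ)..s, (1 + (e t + d (-t)))) =
        (∫ t in (0 : ℝ)..s, (1 + e t)) - ∫ t in (0 : ℝ)..s, -d (-t) := by
      rw [← intervalIntegral.integral_sub (Continuous.intervalIntegrable (by fun_prop) _ _)
        (Continuous.intervalIntegrable (by fun_prop) _ _)]
      congr 1
      ext t
      ring
    rw [hAγ, hBγ, h1, Complex.exp_sub, mul_div_assoc]
  have hest := HalfPlane.norm_sub_one_le_and_norm_inv_sub_one_le hr_pos hr hKr (heK 0)
    ((norm_neg (d 0)).trans_le (hdK 0))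
  -- The Wronskian at `i`; it cannot vanish, as `‖e 0 + d 0‖ ≤ 2K < 1`.
  have hW : 1 + e 0 - -d 0 ≠ 0 := by
    intro h
    have h1 : ‖e 0 + d 0‖ ≤ K + K := norm_add_le_of_le (heK 0) (hdK 0)
    rw [show e 0 + d 0 = -1 by linear_combination h] at h1
    norm_num at h1
    linarith
  have hAB : ∀ z : ℂ, 0 < z.im → A' z * B z - A z * B' z = 1 + e 0 - -d 0 := by
    intro z hz
    rw [hA.wronskian_eq hU hUc.isPreconnected hB hz hI, hA0, hA'0, hB0, hB'0, ← mul_assoc,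
      Complex.I_mul_I]
    ring
  obtain ⟨hf1, hf2, hf3⟩ := hA.sphereQuotient hB hW hAB
  have hfI : HalfPlane.sphereDeriv (HalfPlane.sphereQuotient A B) UpperHalfPlane.I =
      1 + e 0 - -d 0 := by
    rw [hf3 _ (by simp [hB0])]
    simp [hB0]
  have hft : ∀ t : ℝ, 0 < t →
      HalfPlane.sphereQuotient A B (UpperHalfPlane.ofComplex (t * Complex.I)) =
        ((Complex.I * Complex.exp (∫ x in (0 : ℝ)..Real.log t, (1 + (e x + d (-x)))) : ℂ) :
          OnePoint ℂ) := by
    intro t ht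
    have h1 : γ (Real.log t) = t * Complex.I := by
      simp only [γ]
      rw [← Complex.ofReal_exp, Real.exp_log ht]
    rw [← hABγ, HalfPlane.sphereQuotient,
      UpperHalfPlane.ofComplex_apply_of_im_pos (by simpa using ht), h1]
    refine if_neg ?_
    change B (t * Complex.I) ≠ 0
    rw [← h1, hBγ]
    exact Complex.exp_ne_zero _
  have hnorm := HalfPlane.norm_exp_integral_one_add (m := fun t => e t + d (-t))
    (hec.add hdcn) (C := 2 * K)
    fun s => (norm_add_le_of_le (heK s) (hdK (-s))).trans_eq (by ring)
  refine ⟨HalfPlane.sphereQuotient A B, hf1, fun z => ?_, ?_, ?_, ?_, ?_⟩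
  · rw [hf2]
    simp [Q]
  · have h1 : Filter.Tendsto (fun s : ℝ => Real.exp (s + 2 * K * |s|)) Filter.atBot (𝓝 0) := by
      -- For `s ≤ 0` the exponent is `(1 - 2K) s`, with positive slope.
      refine Real.tendsto_exp_atBot.comp ?_
      refine Filter.Tendsto.congr' (f₁ := fun s : ℝ => (1 - 2 * K) * s) ?_
        (Filter.tendsto_id.const_mul_atBot (by linarith))
      filter_upwards [Filter.eventually_le_atBot 0] with s hs
      rw [abs_of_nonpos hs]
      ring
    have h2 : Filter.Tendsto (fun s : ℝ => Complex.I *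
        Complex.exp (∫ x in (0 : ℝ)..s, (1 + (e x + d (-x))))) Filter.atBot (𝓝 0) := by
      refine squeeze_zero_norm (fun s => ?_) h1
      rw [norm_mul, Complex.norm_I, one_mul]
      exact (hnorm s).2
    refine ((OnePoint.continuous_coe.tendsto (0 : ℂ)).comp
      (h2.comp Real.tendsto_log_nhdsGT_zero)).congr' ?_
    filter_upwards [self_mem_nhdsWithin] with t ht
    exact (hft t ht).symm
  · have h1 : Filter.Tendsto (fun s : ℝ => Real.exp (s - 2 * K * |s|)) Filter.atTop
        Filter.atTop := by
      refine Real.tendsto_exp_atTop.comp ?_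
      refine Filter.Tendsto.congr' (f₁ := fun s : ℝ => (1 - 2 * K) * s) ?_
        (Filter.tendsto_id.const_mul_atTop (by linarith))
      filter_upwards [Filter.eventually_ge_atTop 0] with s hs
      rw [abs_of_nonneg hs]
      ring
    have h2 := HalfPlane.tendsto_coe_infty_of_norm (g := fun s : ℝ => Complex.I *
        Complex.exp (∫ x in (0 : ℝ)..s, (1 + (e x + d (-x)))))
      (Filter.tendsto_atTop_mono (fun s => by
        rw [norm_mul, Complex.norm_I, one_mul]
        exact (hnorm s).1) h1)
    refine (h2.comp Real.tendsto_log_atTop).congr' ?_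
    filter_upwards [Filter.eventually_gt_atTop 0] with t ht
    exact (hft t ht).symm
  · simp [HalfPlane.sphereQuotient, hA0, hB0]
  · rw [hfI]
    exact hest
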